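/- Fix a set $K$. A Kripke model $\mathfrak M=\langle W,R,\{P_k\}_{k\in K}\rangle$ consists of a nonempty set $W$, a binary relation $R$ on $W$ and a subset $P_k\subseteq W$ for each $k\in K$; Kripke models are identified with the structures for the first-order signature (with equality) consisting of a binary predicate symbol $\mathbf R$ and unary predicate symbols $\mathbf P_k$ ($k\in K$). Let $\Lambda\subseteq\{\smile,\frown\}$, where $\smile,\frown$ are unary connectives, and let $\mathcal L_\Lambda$ be the language generated by $$\varphi ::= p_k\mid\top\mid\bot\mid\varphi\wedge\varphi\mid\varphi\vee\varphi\mid \star\varphi\qquad(k\in K,\ \star\in\Lambda).$$ The standard translation $\mathrm{st}(x,\varphi)$ of $\varphi\in\mathcal L_\Lambda$ is the first-order formula defined recursively by $\mathrm{st}(x,p_k)=\mathbf P_kx$, $\mathrm{st}(x,\top)=(x=x)$, $\mathrm{st}(x,\bot)={\sim}(x=x)$, $\mathrm{st}(x,\varphi\wedge\psi)=\mathrm{st}(x,\varphi)\wedge\mathrm{st}(x,\psi)$, $\mathrm{st}(x,\varphi\vee\psi)=\mathrm{st}(x,\varphi)\vee\mathrm{st}(x,\psi)$, and, with $y$ a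 fresh variable, $\mathrm{st}(x,\smile\varphi)=\exists y\,(x\mathbf Ry\wedge{\sim}\mathrm{st}(y,\varphi))$ and $\mathrm{st}(x,\frown\varphi)=\forall y\,(x\mathbf Ry\to{\sim}\mathrm{st}(y,\varphi))$. A directed $\Lambda$-simulation between Kripke models $\mathfrak M_1=\langle W_1,R_1,\{P_{k,1}\}_{k\in K}\rangle$ and $\mathfrak M_2=\langle W_2,R_2,\{P_{k,2}\}_{k\in K}\rangle$ is a pair $(F,B)$ of relations $F\subseteq W_1\times W_2$, $B\subseteq W_2\times W_1$ such that - for all $k\in K$: if $(w_1,w_2)\in F$ and $w_1\in P_{k,1}$, then $w_2\in P_{k,2}$; and if $(w_2,w_1)\in B$ and $w_2\in P_{k,2}$, then $w_1\in P_{k,1}$; - if $\smile\,\in\Lambda$: whenever $(w_1,w_2)\in F$ and $w_1R_1v_1$, there is $t_2\in W_2$ with $w_2R_2t_2$ and $(t_2,v_1)\in B$; and whenever $(w_2,w_1)\in B$ and $w_2R_2v_2$, there is $t_1\in W_1$ with $w_1R_1t_1$ and $(t_1,v_2)\in F$; - if $\frown\,\in\Lambda$: whenever $(w_1,w_2)\in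 F$ and $w_2R_2v_2$, there is $t_1\in W_1$ with $w_1R_1t_1$ and $(v_2,t_1)\in B$; and whenever $(w_2,w_1)\in B$ and $w_1R_1v_1$, there is $t_2\in W_2$ with $w_2R_2t_2$ and $(v_1,t_2)\in F$. A first-order formula $\alpha(x)$ is preserved by directed $\Lambda$-simulations if for every directed $\Lambda$-simulation $(F,B)$ between Kripke models $\mathfrak M_1$ and $\mathfrak M_2$ and every $(w_1,w_2)\in F$, $\mathfrak M_1\Vdash\alpha(x)[w_1]$ implies $\mathfrak M_2\Vdash\alpha(x)[w_2]$. **Corollary 6.5 (directed relative characterization).** Let $\Lambda\subseteq\{\smile,\frown\}$ and let $\alpha(x)$ be a first-order formula over the above signature with no free variable other than $x$. Then $\alpha(x)$ is logically equivalent to $\mathrm{st}(x,\varphi)$ for some $\varphi\in\mathcal L_\Lambda$ if and only if $\alpha(x)$ is preserved by directed $\Lambda$-simulations. -/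

import Mathlib

universe u

namespace RestorativeModal

open FirstOrder

/-- The six unary connectives: the negations `⌣` (`smile`) and `⌢` (`frown`), and the restoration
connectives written as a white circle (`consistency` for `⌣`, `determinedness` for `⌢`) or as a
black circle (`inconsistency` for `⌣`, `undeterminedness` for `⌢`). -/
inductive Connective : Type
  | smile
  | frown
  | consistency
  | determinedness
  | inconsistency
  | undeterminedness

/-- A restorative similarity type: a set of the six connectives. -/
abbrev SimilarityType : Type := Set Connective

/-- The modal language `L_Λ` over propositional letters `p_k`, `k ∈ K`. -/
inductive ModalFormula (K : Type u) (Λ : SimilarityType) : Type u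
  | letter (k : K) : ModalFormula K Λ
  | top : ModalFormula K Λ
  | bot : ModalFormula K Λ
  | and (φ ψ : ModalFormula K Λ) : ModalFormula K Λ
  | or (φ ψ : ModalFormula K Λ) : ModalFormula K Λ
  | modal (c : Connective) (hc : c ∈ Λ) (φ : ModalFormula K Λ) : ModalFormula K Λ

/-- A Kripke model: a nonempty set of worlds with an accessibility relation `R` and
a truth set `P k` for each letter `p_k`. -/
structure KripkeModel (K : Type u) : Type (u + 1) where
  World : Type u
  nonempty : Nonempty World
  R : World → World → Prop
  P : K → Set World

/-- Relation symbols: a binary `𝐑` and a unary `𝐏_k` for each `k ∈ K`. -/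
inductive RelSymbol (K : Type u) : ℕ → Type u
  | acc : RelSymbol K 2
  | pred (k : K) : RelSymbol K 1

/-- The first-order signature of Kripke models, without function symbols. -/
def signature (K : Type u) : FirstOrder.Language.{0, u} where
  Functions := fun _ => Empty
  Relations := RelSymbol K

/-- A Kripke model seen as a first-order structure. -/
instance KripkeModel.instStructure {K : Type u} (M : KripkeModel K) :
    (signature K).Structure M.World where
  funMap := fun f => Empty.elim f
  RelMap := fun r =>
    match r with
    | .acc => fun v => M.R (v 0) (v 1)
    | .pred k => fun v => v 0 ∈ M.P k

/-- First-order formulas whose only free variable is `x` (the unique element of `Unit`);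
bound variables are de Bruijn levels. -/
abbrev FOFormula (K : Type u) : Type u := (signature K).Formula Unit

/-- `𝐏_k x` -/
def predAt {K : Type u} {n : ℕ} (k : K) (x : Unit ⊕ Fin n) :
    (signature K).BoundedFormula Unit n :=
  Language.Relations.boundedFormula₁ (L := signature K) (RelSymbol.pred k) (Language.Term.var x)

/-- `x = x` -/
def selfEq {K : Type u} {n : ℕ} (x : Unit ⊕ Fin n) : (signature K).BoundedFormula Unit n :=
  Language.Term.bdEqual (Language.Term.var x) (Language.Term.var x)

/-- `x 𝐑 y`, where `y` is a fresh variable to be bound by the next quantifier. -/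
def accFresh {K : Type u} {n : ℕ} (x : Unit ⊕ Fin n) :
    (signature K).BoundedFormula Unit (n + 1) :=
  Language.Relations.boundedFormula₂ (L := signature K) RelSymbol.acc
    (Language.Term.var (Sum.map id Fin.castSucc x)) (Language.Term.var (Sum.inr (Fin.last n)))

/-- The standard translation `st(x, φ)`, where `x` is the free variable or one of the `n` variables
bound so far. -/
def st {K : Type u} {Λ : SimilarityType} :
    {n : ℕ} → Unit ⊕ Fin n → ModalFormula K Λ → (signature K).BoundedFormula Unit n
  | _, x, .letter k => predAt k x
  | _, x, .top => selfEq x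
  | _, x, .bot => (selfEq x).not
  | _, x, .and φ ψ => st x φ ⊓ st x ψ
  | _, x, .or φ ψ => st x φ ⊔ st x ψ
  | n, x, .modal .smile _ φ => (accFresh x ⊓ (st (Sum.inr (Fin.last n)) φ).not).ex
  | n, x, .modal .frown _ φ => ((accFresh x).imp (st (Sum.inr (Fin.last n)) φ).not).all
  | n, x, .modal .consistency _ φ =>
      (st x φ).not ⊔ ((accFresh x).imp (st (Sum.inr (Fin.last n)) φ)).all
  | n, x, .modal .determinedness _ φ =>
      st x φ ⊔ ((accFresh x).imp (st (Sum.inr (Fin.last n)) φ).not).all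
  | n, x, .modal .inconsistency _ φ =>
      st x φ ⊓ (accFresh x ⊓ (st (Sum.inr (Fin.last n)) φ).not).ex
  | n, x, .modal .undeterminedness _ φ =>
      (st x φ).not ⊓ (accFresh x ⊓ st (Sum.inr (Fin.last n)) φ).ex

/-- The standard translation of a modal formula, as a first-order formula in the free variable
`x`. -/
def standardTranslation {K : Type u} {Λ : SimilarityType} (φ : ModalFormula K Λ) : FOFormula K :=
  st (Sum.inl ()) φ

/-- `M ⊩ α(x)[w]`: the formula `α(x)` holds in `M` when `w` is assigned to `x`. -/
def KripkeModel.SatisfiesAt {K : Type u} (M : KripkeModel K) (α : FOFormula K) (w : M.World) :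
    Prop :=
  Language.Formula.Realize (M := M.World) α (fun _ => w)

/-- Logical equivalence of `α(x)` and `β(x)`, that is, equivalence modulo the empty theory. -/
def Equivalent {K : Type u} (α β : FOFormula K) : Prop :=
  Language.Theory.Iff (∅ : (signature K).Theory) α β

/-- `(F, B)` is a directed `Λ`-simulation between `M₁` and `M₂`; meant for `Λ ⊆ {⌣, ⌢}`. -/
structure IsDirectedSimulation {K : Type u} (Λ : SimilarityType) (M₁ M₂ : KripkeModel K)
    (F : M₁.World → M₂.World → Prop) (B : M₂.World → M₁.World → Prop) : Prop where
  forth_letter : ∀ k w₁ w₂, F w₁ w₂ → w₁ ∈ M₁.P k → w₂ ∈ M₂.P k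
  back_letter : ∀ k w₂ w₁, B w₂ w₁ → w₂ ∈ M₂.P k → w₁ ∈ M₁.P k
  forth_smile : Connective.smile ∈ Λ → ∀ w₁ w₂ v₁, F w₁ w₂ → M₁.R w₁ v₁ →
    ∃ t₂, M₂.R w₂ t₂ ∧ B t₂ v₁
  back_smile : Connective.smile ∈ Λ → ∀ w₂ w₁ v₂, B w₂ w₁ → M₂.R w₂ v₂ →
    ∃ t₁, M₁.R w₁ t₁ ∧ F t₁ v₂
  forth_frown : Connective.frown ∈ Λ → ∀ w₁ w₂ v₂, F w₁ w₂ → M₂.R w₂ v₂ →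
    ∃ t₁, M₁.R w₁ t₁ ∧ B v₂ t₁
  back_frown : Connective.frown ∈ Λ → ∀ w₂ w₁ v₁, B w₂ w₁ → M₁.R w₁ v₁ →
    ∃ t₂, M₂.R w₂ t₂ ∧ F v₁ t₂

/-- `α(x)` is preserved by directed `Λ`-simulations. -/
def PreservedByDirectedSimulations {K : Type u} (Λ : SimilarityType) (α : FOFormula K) : Prop :=
  ∀ (M₁ M₂ : KripkeModel K) (F : M₁.World → M₂.World → Prop) (B : M₂.World → M₁.World → Prop),
    IsDirectedSimulation Λ M₁ M₂ F B →
      ∀ (w₁ : M₁.World) (w₂ : M₂.World), F w₁ w₂ → M₁.SatisfiesAt α w₁ → M₂.SatisfiesAt α w₂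

end RestorativeModal

/-! Modal formulas are preserved by induction. For the converse, suppose that `α` is preserved but
has no modal equivalent, and fix the finite set `s` of letters on which `α` depends. A finite set of
modal formulas realises finitely many types, so a property invariant under inclusion of these types
is a disjunction of conjunctions (`exists_modal_definition`). Hence for each `n` some pointed models
satisfy inclusion for formulas of depth at most `n`, while `α` holds at the first and fails at the
second.

In the ultraproducts of the two sequences over a nonprincipal ultrafilter, Łoś's theorem keeps `α`
true on one side and false on the other, and makes the inclusion hold at every depth. Countable
saturation (`exists_diagonal_witness`) makes modal inclusion, taken in both directions, a directed
simulation (`isDirectedSimulation_modalInclusion`), a contradiction. -/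

namespace RestorativeModal

open FirstOrder Filter

variable {K : Type u} {Λ : SimilarityType}

/-! ### Kripke semantics and the standard translation -/

/-- The truth of a modal formula at a world of a Kripke model. -/
def KripkeModel.Sat (M : KripkeModel K) : M.World → ModalFormula K Λ → Prop
  | w, .letter k => w ∈ M.P k
  | _, .top => True
  | _, .bot => False
  | w, .and φ ψ => M.Sat w φ ∧ M.Sat w ψ
  | w, .or φ ψ => M.Sat w φ ∨ M.Sat w ψ
  | w, .modal .smile _ φ => ∃ v, M.R w v ∧ ¬M.Sat v φ
  | w, .modal .frown _ φ => ∀ v, M.R w v → ¬M.Sat v φ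
  | w, .modal .consistency _ φ => ¬M.Sat w φ ∨ ∀ v, M.R w v → M.Sat v φ
  | w, .modal .determinedness _ φ => M.Sat w φ ∨ ∀ v, M.R w v → ¬M.Sat v φ
  | w, .modal .inconsistency _ φ => M.Sat w φ ∧ ∃ v, M.R w v ∧ ¬M.Sat v φ
  | w, .modal .undeterminedness _ φ => ¬M.Sat w φ ∧ ∃ v, M.R w v ∧ M.Sat v φ

theorem realize_accFresh (M : KripkeModel K) {n : ℕ} (x : Unit ⊕ Fin n) (v : Unit → M.World)
    (xs : Fin n → M.World) (a : M.World) :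
    (accFresh (K := K) x).Realize v (Fin.snoc xs a : Fin (n + 1) → M.World) ↔
      M.R (Sum.elim v xs x) a := by
  refine (Language.BoundedFormula.realize_rel₂ (L := signature K)).trans ?_
  change M.R _ _ ↔ _
  rcases x with x | x <;> simp

theorem realize_st (M : KripkeModel K) (φ : ModalFormula K Λ) :
    ∀ {n : ℕ} (x : Unit ⊕ Fin n) (v : Unit → M.World) (xs : Fin n → M.World),
      (st x φ).Realize v xs ↔ M.Sat (Sum.elim v xs x) φ := by
  induction φ with
  | letter k =>
    intro n x v xs
    exact (Language.BoundedFormula.realize_rel₁ (L := signature K)).trans Iff.rfl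
  | top => intro n x v xs; simp [st, selfEq, KripkeModel.Sat]
  | bot => intro n x v xs; simp [st, selfEq, KripkeModel.Sat]
  | and φ ψ h₁ h₂ => intro n x v xs; simp [st, KripkeModel.Sat, h₁, h₂]
  | or φ ψ h₁ h₂ => intro n x v xs; simp [st, KripkeModel.Sat, h₁, h₂]
  | modal c hc φ h =>
    intro n x v xs
    cases c <;> simp [st, KripkeModel.Sat, h, realize_accFresh]

theorem satisfiesAt_standardTranslation (M : KripkeModel K) (φ : ModalFormula K Λ) (w : M.World) :
    M.SatisfiesAt (standardTranslation φ) w ↔ M.Sat w φ :=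
  realize_st M φ _ _ _

/-! ### First-order structures as Kripke models -/

/-- The Kripke model of a first-order structure. -/
def KripkeModel.ofStructure (W : Type u) [Nonempty W] [(signature K).Structure W] :
    KripkeModel K where
  World := W
  nonempty := inferInstance
  R a b := Language.Structure.RelMap (L := signature K) RelSymbol.acc ![a, b]
  P k := {a | Language.Structure.RelMap (L := signature K) (RelSymbol.pred k) ![a]}

theorem instStructure_ofStructure (W : Type u) [Nonempty W] [S : (signature K).Structure W] :
    (KripkeModel.ofStructure (K := K) W).instStructure = S := by
  refine Language.Structure.ext ?_ ?_
  · funext n f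
    exact Empty.elim f
  · funext n r v
    cases r with
    | acc =>
      have hv : (![v 0, v 1] : Fin 2 → W) = v := by funext i; fin_cases i <;> rfl
      exact congrArg (S.RelMap RelSymbol.acc) hv
    | pred k =>
      have hv : (![v 0] : Fin 1 → W) = v := by funext i; fin_cases i; rfl
      exact congrArg (S.RelMap (RelSymbol.pred k)) hv

theorem satisfiesAt_ofStructure (W : Type u) [Nonempty W] [S : (signature K).Structure W]
    (α : FOFormula K) (w : W) :
    (KripkeModel.ofStructure (K := K) W).SatisfiesAt α w ↔ α.Realize (fun _ => w) := by
  unfold KripkeModel.SatisfiesAt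
  rw [instStructure_ofStructure W]
  rfl

/-- Every nonempty structure for the signature is the structure of a Kripke model, so testing on
Kripke models suffices. -/
theorem equivalent_iff {α β : FOFormula K} :
    Equivalent α β ↔ ∀ (M : KripkeModel K) (w : M.World),
      M.SatisfiesAt α w ↔ M.SatisfiesAt β w := by
  constructor
  · intro h M w
    have := M.nonempty
    exact Language.Theory.Iff.realize_iff (M := M.World) (T := ∅) h
  · intro h M v xs
    rw [Language.BoundedFormula.realize_iff]
    have hM := h (KripkeModel.ofStructure M) (v ())
    rw [satisfiesAt_ofStructure, satisfiesAt_ofStructure] at hM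
    have hv : v = fun _ => v () := funext fun _ => rfl
    rw [Subsingleton.elim xs default, hv]
    exact hM

/-! ### Modal formulas are preserved -/

/-- Both negations reverse truth, so the step for `F` needs the hypothesis for `B` and vice versa;
the two halves must be proved together. -/
theorem IsDirectedSimulation.sat_mono (hΛ : Λ ⊆ {Connective.smile, Connective.frown})
    {M₁ M₂ : KripkeModel K} {F : M₁.World → M₂.World → Prop} {B : M₂.World → M₁.World → Prop}
    (h : IsDirectedSimulation Λ M₁ M₂ F B) (φ : ModalFormula K Λ) :
    (∀ w₁ w₂, F w₁ w₂ → M₁.Sat w₁ φ → M₂.Sat w₂ φ) ∧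
      (∀ w₂ w₁, B w₂ w₁ → M₂.Sat w₂ φ → M₁.Sat w₁ φ) := by
  induction φ with
  | letter k => exact ⟨h.forth_letter k, h.back_letter k⟩
  | top => exact ⟨fun _ _ _ _ => trivial, fun _ _ _ _ => trivial⟩
  | bot => exact ⟨fun _ _ _ => id, fun _ _ _ => id⟩
  | and φ ψ h₁ h₂ =>
    exact ⟨fun _ _ hF => And.imp (h₁.1 _ _ hF) (h₂.1 _ _ hF),
      fun _ _ hB => And.imp (h₁.2 _ _ hB) (h₂.2 _ _ hB)⟩
  | or φ ψ h₁ h₂ =>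
    exact ⟨fun _ _ hF => Or.imp (h₁.1 _ _ hF) (h₂.1 _ _ hF),
      fun _ _ hB => Or.imp (h₁.2 _ _ hB) (h₂.2 _ _ hB)⟩
  | modal c hc φ ih =>
    rcases hΛ hc with rfl | rfl
    · constructor
      · rintro w₁ w₂ hF ⟨v, hv, hφ⟩
        obtain ⟨t, ht, hB⟩ := h.forth_smile hc _ _ _ hF hv
        exact ⟨t, ht, fun hs => hφ (ih.2 _ _ hB hs)⟩
      · rintro w₂ w₁ hB ⟨v, hv, hφ⟩
        obtain ⟨t, ht, hF⟩ := h.back_smile hc _ _ _ hB hv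
        exact ⟨t, ht, fun hs => hφ (ih.1 _ _ hF hs)⟩
    · constructor
      · intro w₁ w₂ hF hs v hv hφ
        obtain ⟨t, ht, hB⟩ := h.forth_frown hc _ _ _ hF hv
        exact hs t ht (ih.2 _ _ hB hφ)
      · intro w₂ w₁ hB hs v hv hφ
        obtain ⟨t, ht, hF⟩ := h.back_frown hc _ _ _ hB hv
        exact hs t ht (ih.1 _ _ hF hφ)

/-! ### Restriction to finitely many letters -/

/-- The Kripke model in which the truth sets of the letters outside `s` are emptied. -/
def KripkeModel.restrict (M : KripkeModel K) (s : Set K) : KripkeModel K where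
  World := M.World
  nonempty := M.nonempty
  R := M.R
  P k := {w | k ∈ s ∧ w ∈ M.P k}

theorem realize_term_restrict {β : Type} (M : KripkeModel K) (s : Set K)
    (t : (signature K).Term β) (v : β → M.World) :
    Language.Term.realize (M := (M.restrict s).World) v t = t.realize v := by
  cases t with
  | var _ => rfl
  | func f _ => exact Empty.elim f

/-- The letters occurring in `α` suffice. Allowing every larger `s` lets the implication case take a
union. -/
theorem exists_finite_realize_restrict {n : ℕ} (α : (signature K).BoundedFormula Unit n) :
    ∃ s₀ : Set K, s₀.Finite ∧ ∀ s, s₀ ⊆ s → ∀ (M : KripkeModel K) (v : Unit → M.World)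
      (xs : Fin n → M.World),
      Language.BoundedFormula.Realize (M := (M.restrict s).World) α v xs ↔ α.Realize v xs := by
  induction α with
  | falsum => exact ⟨∅, Set.finite_empty, fun _ _ _ _ _ => Iff.rfl⟩
  | equal t₁ t₂ =>
    refine ⟨∅, Set.finite_empty, fun s _ M v xs => ?_⟩
    exact Eq.congr (realize_term_restrict M s t₁ _) (realize_term_restrict M s t₂ _)
  | rel r ts =>
    cases r with
    | acc =>
      refine ⟨∅, Set.finite_empty, fun s _ M v xs => ?_⟩
      exact iff_of_eq (congrArg₂ M.R (realize_term_restrict M s (ts 0) _)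
        (realize_term_restrict M s (ts 1) _))
    | pred k =>
      refine ⟨{k}, Set.finite_singleton k, fun s hs M v xs => ?_⟩
      exact (and_iff_right (hs rfl)).trans
        (iff_of_eq (congrArg (· ∈ M.P k) (realize_term_restrict M s (ts 0) _)))
  | imp α β h₁ h₂ =>
    obtain ⟨s₁, hs₁, h₁⟩ := h₁
    obtain ⟨s₂, hs₂, h₂⟩ := h₂
    refine ⟨s₁ ∪ s₂, hs₁.union hs₂, fun s hs M v xs => ?_⟩
    exact imp_congr (h₁ s (Set.subset_union_left.trans hs) M v xs)
      (h₂ s (Set.subset_union_right.trans hs) M v xs)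
  | all α h =>
    obtain ⟨s₀, hs₀, h⟩ := h
    exact ⟨s₀, hs₀, fun s hs M v xs => forall_congr' fun a => h s hs M v _⟩

/-! ### An increasing sequence of finite sets of modal formulas -/

theorem finite_connective : Finite Connective :=
  (Set.finite_univ_iff (α := Connective)).1 <|
    (Set.toFinite {.smile, .frown, .consistency, .determinedness, .inconsistency,
      .undeterminedness}).subset fun c _ => by cases c <;> simp

/-- The modal formulas over the letters in `s` of nesting depth at most `n`. -/
def formulasUpTo (Λ : SimilarityType) (s : Set K) : ℕ → Set (ModalFormula K Λ)
  | 0 => {.top, .bot} ∪ .letter '' s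
  | n + 1 => formulasUpTo Λ s n ∪ Set.image2 .and (formulasUpTo Λ s n) (formulasUpTo Λ s n) ∪
      Set.image2 .or (formulasUpTo Λ s n) (formulasUpTo Λ s n) ∪
      ⋃ (c : Connective) (hc : c ∈ Λ), .modal c hc '' formulasUpTo Λ s n

/-- Depth counts conjunctions and disjunctions too, so each level is literally finite, with no
passage to equivalence classes. -/
theorem finite_formulasUpTo {s : Set K} (hs : s.Finite) (n : ℕ) :
    (formulasUpTo Λ s n).Finite := by
  induction n with
  | zero => exact (Set.toFinite _).union (hs.image _)
  | succ n ih =>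
    have := finite_connective
    exact ((ih.union (ih.image2 _ ih)).union (ih.image2 _ ih)).union <|
      Set.finite_iUnion fun c => Set.finite_iUnion fun hc => ih.image _

theorem formulasUpTo_mono (s : Set K) : Monotone (formulasUpTo Λ s) :=
  monotone_nat_of_le_succ fun _ _ h => .inl (.inl (.inl h))

/-- The modal formulas over the letters in `s`. -/
def formulasOver (Λ : SimilarityType) (s : Set K) : Set (ModalFormula K Λ) :=
  ⋃ n, formulasUpTo Λ s n

section formulasOver

variable {s : Set K} {φ ψ : ModalFormula K Λ}

theorem letter_mem_formulasOver {k : K} (hk : k ∈ s) : .letter k ∈ formulasOver Λ s :=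
  Set.mem_iUnion.2 ⟨0, .inr ⟨k, hk, rfl⟩⟩

theorem top_mem_formulasOver : .top ∈ formulasOver Λ s :=
  Set.mem_iUnion.2 ⟨0, .inl (.inl rfl)⟩

theorem bot_mem_formulasOver : .bot ∈ formulasOver Λ s :=
  Set.mem_iUnion.2 ⟨0, .inl (.inr rfl)⟩

theorem exists_mem_formulasUpTo (hφ : φ ∈ formulasOver Λ s) (hψ : ψ ∈ formulasOver Λ s) :
    ∃ n, φ ∈ formulasUpTo Λ s n ∧ ψ ∈ formulasUpTo Λ s n := by
  obtain ⟨m, hm⟩ := Set.mem_iUnion.1 hφ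
  obtain ⟨n, hn⟩ := Set.mem_iUnion.1 hψ
  exact ⟨max m n, formulasUpTo_mono s (le_max_left m n) hm,
    formulasUpTo_mono s (le_max_right m n) hn⟩

theorem and_mem_formulasOver (hφ : φ ∈ formulasOver Λ s) (hψ : ψ ∈ formulasOver Λ s) :
    φ.and ψ ∈ formulasOver Λ s := by
  obtain ⟨n, h₁, h₂⟩ := exists_mem_formulasUpTo hφ hψ
  exact Set.mem_iUnion.2 ⟨n + 1, .inl (.inl (.inr ⟨φ, h₁, ψ, h₂, rfl⟩))⟩

theorem or_mem_formulasOver (hφ : φ ∈ formulasOver Λ s) (hψ : ψ ∈ formulasOver Λ s) :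
    φ.or ψ ∈ formulasOver Λ s := by
  obtain ⟨n, h₁, h₂⟩ := exists_mem_formulasUpTo hφ hψ
  exact Set.mem_iUnion.2 ⟨n + 1, .inl (.inr ⟨φ, h₁, ψ, h₂, rfl⟩)⟩

theorem modal_mem_formulasOver {c : Connective} (hc : c ∈ Λ) (hφ : φ ∈ formulasOver Λ s) :
    .modal c hc φ ∈ formulasOver Λ s := by
  obtain ⟨n, hn⟩ := Set.mem_iUnion.1 hφ
  exact Set.mem_iUnion.2 ⟨n + 1, .inr (Set.mem_iUnion₂.2 ⟨c, hc, φ, hn, rfl⟩)⟩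

end formulasOver

theorem exists_conjunction {s : Set K} {T : Set (ModalFormula K Λ)} (hT : T.Finite) :
    T ⊆ formulasOver Λ s → ∃ ψ ∈ formulasOver Λ s, ∀ (M : KripkeModel K) (w : M.World),
      M.Sat w ψ ↔ ∀ φ ∈ T, M.Sat w φ := by
  induction T, hT using Set.Finite.induction_on with
  | empty => exact fun _ => ⟨.top, top_mem_formulasOver, by simp [KripkeModel.Sat]⟩
  | @insert φ T _ _ ih =>
    intro h
    obtain ⟨ψ, hψ, hs⟩ := ih ((Set.subset_insert _ _).trans h)
    exact ⟨φ.and ψ, and_mem_formulasOver (h (Set.mem_insert _ _)) hψ,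
      by simp [KripkeModel.Sat, hs]⟩

theorem exists_disjunction {s : Set K} {T : Set (ModalFormula K Λ)} (hT : T.Finite) :
    T ⊆ formulasOver Λ s → ∃ ψ ∈ formulasOver Λ s, ∀ (M : KripkeModel K) (w : M.World),
      M.Sat w ψ ↔ ∃ φ ∈ T, M.Sat w φ := by
  induction T, hT using Set.Finite.induction_on with
  | empty => exact fun _ => ⟨.bot, bot_mem_formulasOver, by simp [KripkeModel.Sat]⟩
  | @insert φ T _ _ ih =>
    intro h
    obtain ⟨ψ, hψ, hs⟩ := ih ((Set.subset_insert _ _).trans h)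
    exact ⟨φ.or ψ, or_mem_formulasOver (h (Set.mem_insert _ _)) hψ,
      by simp [KripkeModel.Sat, hs]⟩

/-- A property of pointed models that is preserved by inclusion of the truths among a finite set of
modal formulas is expressed by a modal formula. -/
theorem exists_modal_definition {s : Set K} {S : Set (ModalFormula K Λ)} (hS : S.Finite)
    (hSs : S ⊆ formulasOver Λ s) (A : ∀ M : KripkeModel K, M.World → Prop)
    (hA : ∀ (M₁ M₂ : KripkeModel K) (w₁ : M₁.World) (w₂ : M₂.World),
      (∀ φ ∈ S, M₁.Sat w₁ φ → M₂.Sat w₂ φ) → A M₁ w₁ → A M₂ w₂) :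
    ∃ ψ : ModalFormula K Λ, ∀ (M : KripkeModel K) (w : M.World), A M w ↔ M.Sat w ψ := by
  have hconj : ∀ T ⊆ S, ∃ ψ ∈ formulasOver Λ s, ∀ (M : KripkeModel K) (w : M.World),
      M.Sat w ψ ↔ ∀ φ ∈ T, M.Sat w φ :=
    fun T hT => exists_conjunction (hS.subset hT) (hT.trans hSs)
  have : Nonempty (ModalFormula K Λ) := ⟨.top⟩
  choose! χ hχs hχ using hconj
  -- The types over `S` realised where `A` holds. The pointed models are unrestricted, but the types
  -- are subsets of the finite set `S`; `ψ` has one disjunct for each.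
  let types : Set (Set (ModalFormula K Λ)) :=
    {T | ∃ (M : KripkeModel K) (w : M.World), A M w ∧ T = {φ ∈ S | M.Sat w φ}}
  have htypes : types ⊆ 𝒫 S := by
    rintro _ ⟨M, w, _, rfl⟩
    exact Set.sep_subset _ _
  obtain ⟨ψ, _, hψ⟩ := exists_disjunction (s := s) ((hS.powerset.subset htypes).image χ)
    (Set.image_subset_iff.2 fun T hT => hχs T (htypes hT))
  refine ⟨ψ, fun M w => ?_⟩
  rw [hψ, Set.exists_mem_image]
  constructor
  · exact fun h => ⟨_, ⟨M, w, h, rfl⟩, (hχ _ (Set.sep_subset _ _) M w).2 fun φ hφ => hφ.2⟩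
  · rintro ⟨T, hT, hw⟩
    rw [hχ T (htypes hT)] at hw
    obtain ⟨M', w', hA', rfl⟩ := hT
    exact hA M' M w' w (fun φ hφ h => hw φ ⟨hφ, h⟩) hA'

/-! ### Ultraproducts -/

/-- Countable saturation of ultraproducts over `ℕ`, in terms of representatives. -/
theorem exists_diagonal_witness {W : ℕ → Type*} [∀ i, Nonempty (W i)] (Q : ∀ i, ℕ → W i → Prop)
    (hQ : ∀ i m n t, m ≤ n → Q i n t → Q i m t)
    (h : ∀ n, ∀ᶠ i in (hyperfilter ℕ : Filter ℕ), ∃ t, Q i n t) :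
    ∃ t : ∀ i, W i, ∀ n, ∀ᶠ i in (hyperfilter ℕ : Filter ℕ), Q i n (t i) := by
  classical
  -- In coordinate `i`, take a witness for the largest attainable `n ≤ i`; by `hQ` it serves every
  -- smaller index. The bound `i` is harmless because the ultrafilter contains all cofinite sets.
  have hex : ∀ i, ∃ t : W i, ∀ n ≤ i, (∃ t', Q i n t') → Q i n t := by
    intro i
    by_cases h₀ : ∃ n ≤ i, ∃ t', Q i n t'
    · obtain ⟨n, hn, t', ht'⟩ := h₀
      obtain ⟨t, ht⟩ := Nat.findGreatest_spec (P := fun n => ∃ t', Q i n t') hn ⟨t', ht'⟩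
      exact ⟨t, fun m hm hm' => hQ _ _ _ _ (Nat.le_findGreatest hm hm') ht⟩
    · exact ⟨Classical.arbitrary _, fun n hn hn' => absurd ⟨n, hn, hn'⟩ h₀⟩
  choose t ht using hex
  refine ⟨t, fun n => ?_⟩
  have hn : ∀ᶠ i in (hyperfilter ℕ : Filter ℕ), n ≤ i :=
    Nat.hyperfilter_le_atTop (eventually_ge_atTop n)
  filter_upwards [hn, h n] with i hi hi'
  exact ht i n hi hi'

instance KripkeModel.instNonempty (M : KripkeModel K) : Nonempty M.World := M.nonempty

/-- The ultraproduct of a sequence of Kripke models by the hyperfilter on `ℕ`. -/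
noncomputable def ultraproduct (M : ℕ → KripkeModel K) : KripkeModel K :=
  @KripkeModel.ofStructure K ((hyperfilter ℕ : Filter ℕ).Product fun i => (M i).World)
    Language.Ultraproduct.Product.instNonempty Language.Ultraproduct.structure

/-- The world of the ultraproduct represented by a sequence of worlds. -/
noncomputable def ultraproduct.mk {M : ℕ → KripkeModel K} (w : ∀ i, (M i).World) : (ultraproduct M).World :=
  Quotient.mk _ w

theorem ultraproduct.exists_rep {M : ℕ → KripkeModel K} (w : (ultraproduct M).World) :
    ∃ w' : ∀ i, (M i).World, mk w' = w :=
  Quotient.exists_rep w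

theorem ultraproduct.satisfiesAt_mk (M : ℕ → KripkeModel K) (α : FOFormula K)
    (w : ∀ i, (M i).World) :
    (ultraproduct M).SatisfiesAt α (mk w) ↔
      ∀ᶠ i in (hyperfilter ℕ : Filter ℕ), (M i).SatisfiesAt α (w i) :=
  (@satisfiesAt_ofStructure K _ Language.Ultraproduct.Product.instNonempty _ α _).trans
    (Language.Ultraproduct.realize_formula_cast α fun _ => w)

theorem ultraproduct.sat_mk (M : ℕ → KripkeModel K) (φ : ModalFormula K Λ)
    (w : ∀ i, (M i).World) :
    (ultraproduct M).Sat (mk w) φ ↔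
      ∀ᶠ i in (hyperfilter ℕ : Filter ℕ), (M i).Sat (w i) φ := by
  simp only [← satisfiesAt_standardTranslation, satisfiesAt_mk]

theorem ultraproduct.R_mk (M : ℕ → KripkeModel K) (w v : ∀ i, (M i).World) :
    (ultraproduct M).R (mk w) (mk v) ↔
      ∀ᶠ i in (hyperfilter ℕ : Filter ℕ), (M i).R (w i) (v i) := by
  have h := Language.relMap_quotient_mk' (L := signature K)
    (s := (hyperfilter ℕ : Filter ℕ).productSetoid fun i => (M i).World) RelSymbol.acc ![w, v]
  -- The relation on the product is defined on tuples of classes coming from a tuple of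
  -- representatives.
  have hmk : ![mk w, mk v] = fun i => (mk (![w, v] i) : (ultraproduct M).World) := by
    funext i
    fin_cases i <;> rfl
  refine (iff_of_eq (congrArg (Language.Structure.RelMap (L := signature K)
    (M := (hyperfilter ℕ : Filter ℕ).Product fun i => (M i).World) RelSymbol.acc) hmk)).trans ?_
  exact h

/-- `w₂` verifies all the modal formulas over the letters in `s` that `w₁` verifies. -/
def ModalInclusion (Λ : SimilarityType) (s : Set K) (M₁ M₂ : KripkeModel K) (w₁ : M₁.World)
    (w₂ : M₂.World) : Prop :=
  ∀ φ ∈ formulasOver Λ s, M₁.Sat w₁ φ → M₂.Sat w₂ φ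

variable {s : Set K}

/-- The successor `t` must refute all that `v` refutes. At level `n`, the disjunction of the
formulas refuted at `v` is refuted there, so its `⌣` holds at `w₁`, hence at `w₂`, which yields a
successor refuting that finite set. Saturation handles all levels at once. -/
theorem ModalInclusion.exists_of_smile (hs : s.Finite) (hc : Connective.smile ∈ Λ)
    {M₁ : KripkeModel K} {M : ℕ → KripkeModel K} {w₁ : M₁.World} {w₂ : (ultraproduct M).World}
    (h : ModalInclusion Λ s M₁ (ultraproduct M) w₁ w₂) {v : M₁.World} (hv : M₁.R w₁ v) :
    ∃ t, (ultraproduct M).R w₂ t ∧ ModalInclusion Λ s (ultraproduct M) M₁ t v := by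
  obtain ⟨w, rfl⟩ := ultraproduct.exists_rep w₂
  obtain ⟨t, ht⟩ := exists_diagonal_witness (W := fun i => (M i).World)
    (fun i n t => (M i).R (w i) t ∧ ∀ φ ∈ formulasUpTo Λ s n, ¬M₁.Sat v φ → ¬(M i).Sat t φ)
    (fun i m n t hmn ht => ⟨ht.1, fun φ hφ => ht.2 φ (formulasUpTo_mono s hmn hφ)⟩) <| by
      intro n
      obtain ⟨ψ, hψ, hψs⟩ := exists_disjunction (s := s)
        (T := {φ ∈ formulasUpTo Λ s n | ¬M₁.Sat v φ})
        ((finite_formulasUpTo hs n).subset (Set.sep_subset _ _))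
        ((Set.sep_subset _ _).trans (Set.subset_iUnion _ n))
      have hw := h _ (modal_mem_formulasOver hc hψ)
        ⟨v, hv, fun hvψ => by obtain ⟨φ, hφ, hvφ⟩ := (hψs _ _).1 hvψ; exact hφ.2 hvφ⟩
      rw [ultraproduct.sat_mk] at hw
      filter_upwards [hw] with i hi
      obtain ⟨t, ht, htψ⟩ := hi
      exact ⟨t, ht, fun φ hφ hvφ htφ => htψ ((hψs _ _).2 ⟨φ, ⟨hφ, hvφ⟩, htφ⟩)⟩
  refine ⟨ultraproduct.mk t, (ultraproduct.R_mk M w t).2 ((ht 0).mono fun i hi => hi.1), ?_⟩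
  intro φ hφ htφ
  by_contra hvφ
  obtain ⟨n, hn⟩ := Set.mem_iUnion.1 hφ
  obtain ⟨i, hi, hi'⟩ := ((ht n).and ((ultraproduct.sat_mk M φ t).1 htφ)).exists
  exact hi.2 φ hn hvφ hi'

/-- Dually, `t` must verify all that `v` verifies. If no successor of `w₁` verified the conjunction
of the level `n` truths of `v`, its `⌢` would hold at `w₁`, hence at `w₂`, contradicting `v`. -/
theorem ModalInclusion.exists_of_frown (hs : s.Finite) (hc : Connective.frown ∈ Λ)
    {M : ℕ → KripkeModel K} {M₂ : KripkeModel K} {w₁ : (ultraproduct M).World} {w₂ : M₂.World}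
    (h : ModalInclusion Λ s (ultraproduct M) M₂ w₁ w₂) {v : M₂.World} (hv : M₂.R w₂ v) :
    ∃ t, (ultraproduct M).R w₁ t ∧ ModalInclusion Λ s M₂ (ultraproduct M) v t := by
  obtain ⟨w, rfl⟩ := ultraproduct.exists_rep w₁
  obtain ⟨t, ht⟩ := exists_diagonal_witness (W := fun i => (M i).World)
    (fun i n t => (M i).R (w i) t ∧ ∀ φ ∈ formulasUpTo Λ s n, M₂.Sat v φ → (M i).Sat t φ)
    (fun i m n t hmn ht => ⟨ht.1, fun φ hφ => ht.2 φ (formulasUpTo_mono s hmn hφ)⟩) <| by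
      intro n
      obtain ⟨ψ, hψ, hψs⟩ := exists_conjunction (s := s)
        (T := {φ ∈ formulasUpTo Λ s n | M₂.Sat v φ})
        ((finite_formulasUpTo hs n).subset (Set.sep_subset _ _))
        ((Set.sep_subset _ _).trans (Set.subset_iUnion _ n))
      have hw := mt (h _ (modal_mem_formulasOver hc hψ))
        fun h' => h' v hv ((hψs _ _).2 fun φ hφ => hφ.2)
      rw [ultraproduct.sat_mk, ← Ultrafilter.eventually_not] at hw
      filter_upwards [hw] with i hi
      simp only [KripkeModel.Sat, not_forall, not_not] at hi
      obtain ⟨t, ht, htψ⟩ := hi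
      exact ⟨t, ht, fun φ hφ hvφ => (hψs _ _).1 htψ φ ⟨hφ, hvφ⟩⟩
  refine ⟨ultraproduct.mk t, (ultraproduct.R_mk M w t).2 ((ht 0).mono fun i hi => hi.1), ?_⟩
  intro φ hφ hvφ
  obtain ⟨n, hn⟩ := Set.mem_iUnion.1 hφ
  exact (ultraproduct.sat_mk M φ t).2 ((ht n).mono fun i hi => hi.2 φ hn hvφ)

/-- Modal inclusion is a directed simulation between ultraproducts. -/
theorem isDirectedSimulation_modalInclusion (hs : s.Finite) (M N : ℕ → KripkeModel K) :
    IsDirectedSimulation Λ ((ultraproduct M).restrict s) ((ultraproduct N).restrict s)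
      (ModalInclusion Λ s (ultraproduct M) (ultraproduct N))
      (ModalInclusion Λ s (ultraproduct N) (ultraproduct M)) where
  -- Restriction empties the letters outside `s`, about which inclusion over `s` says nothing;
  -- worlds and accessibility are unchanged.
  forth_letter k _ _ h hw := ⟨hw.1, h (.letter k) (letter_mem_formulasOver hw.1) hw.2⟩
  back_letter k _ _ h hw := ⟨hw.1, h (.letter k) (letter_mem_formulasOver hw.1) hw.2⟩
  forth_smile hc _ _ _ h hv := h.exists_of_smile hs hc hv
  back_smile hc _ _ _ h hv := h.exists_of_smile hs hc hv
  forth_frown hc _ _ _ h hv := h.exists_of_frown hs hc hv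
  back_frown hc _ _ _ h hv := h.exists_of_frown hs hc hv

/-- A formula preserved by directed simulations is equivalent to a modal formula. -/
theorem exists_equivalent_of_preserved {α : FOFormula K}
    (hα : PreservedByDirectedSimulations Λ α) :
    ∃ φ : ModalFormula K Λ, Equivalent α (standardTranslation φ) := by
  obtain ⟨s, hs, hres⟩ := exists_finite_realize_restrict α
  have hres' (M : KripkeModel K) (w : M.World) :
      (M.restrict s).SatisfiesAt α w ↔ M.SatisfiesAt α w := by
    refine (hres s subset_rfl M (fun _ => w) default)
  by_contra hne
  have hcounter (n : ℕ) : ∃ (M₁ M₂ : KripkeModel K) (w₁ : M₁.World) (w₂ : M₂.World),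
      (∀ φ ∈ formulasUpTo Λ s n, M₁.Sat w₁ φ → M₂.Sat w₂ φ) ∧
        M₁.SatisfiesAt α w₁ ∧ ¬M₂.SatisfiesAt α w₂ := by
    by_contra! hcon
    obtain ⟨ψ, hψ⟩ := exists_modal_definition (finite_formulasUpTo hs n)
      (Set.subset_iUnion _ n) (fun M w => M.SatisfiesAt α w) hcon
    exact hne ⟨ψ, equivalent_iff.2 fun M w => by rw [hψ, satisfiesAt_standardTranslation]⟩
  choose M N w v hwv hw hv using hcounter
  have hincl : ModalInclusion Λ s (ultraproduct M) (ultraproduct N) (ultraproduct.mk w)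
      (ultraproduct.mk v) := by
    intro φ hφ h
    obtain ⟨n, hn⟩ := Set.mem_iUnion.1 hφ
    rw [ultraproduct.sat_mk] at h ⊢
    -- A formula of level `n` is transferred in every coordinate `i ≥ n`, hence almost everywhere.
    have hle : ∀ᶠ i in (hyperfilter ℕ : Filter ℕ), n ≤ i :=
      Nat.hyperfilter_le_atTop (eventually_ge_atTop n)
    filter_upwards [h, hle] with i hi hni
    exact hwv i φ (formulasUpTo_mono s hni hn) hi
  -- Preservation is applied to the restricted ultraproducts; `hres'` carries `α` to and from the
  -- unrestricted ones.
  have hcl := hα _ _ _ _ (isDirectedSimulation_modalInclusion hs M N) _ _ hincl <|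
    (hres' _ _).2 <| (ultraproduct.satisfiesAt_mk M α w).2 (.of_forall hw)
  rw [hres', ultraproduct.satisfiesAt_mk] at hcl
  obtain ⟨i, hi⟩ := hcl.exists
  exact hv i hi

end RestorativeModal

theorem corollary6p5 {K : Type u} (Λ : RestorativeModal.SimilarityType)
    (hΛ : Λ ⊆ {RestorativeModal.Connective.smile, RestorativeModal.Connective.frown})
    (α : RestorativeModal.FOFormula K) :
    (∃ φ : RestorativeModal.ModalFormula K Λ,
        RestorativeModal.Equivalent α (RestorativeModal.standardTranslation φ)) ↔
      RestorativeModal.PreservedByDirectedSimulations Λ α := by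
  refine ⟨?_, RestorativeModal.exists_equivalent_of_preserved⟩
  rintro ⟨φ, hφ⟩ M₁ M₂ F B h w₁ w₂ hF
  rw [RestorativeModal.equivalent_iff.1 hφ, RestorativeModal.equivalent_iff.1 hφ,
    RestorativeModal.satisfiesAt_standardTranslation,
    RestorativeModal.satisfiesAt_standardTranslation]
  exact (h.sat_mono hΛ φ).1 _ _ hF
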